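/- Let $k$ be a field, let $a>b>0$ be integers with $\gcd(a,b)=1$, let $H=\langle a,b\rangle=\{pa+qb\mid p,q\in\mathbb{N}\}$, and let $R=k[\![H]\!]$ be the (complete) numerical semigroup ring, that is, the ring of the formal power series over $k$ in one variable $t$ all of whose exponents lie in $H$. Let $Q$ be the total quotient ring of $R$, let $S$ be the integral closure of $R$ in $Q$, and let $\mathfrak{c}=R:_QS=\{q\in Q\mid qS\subseteq R\}$ be the conductor of $R$, which is an ideal of $R$. Let $\operatorname{mod}R$ be the category of finitely generated $R$-modules. A subcategory of $\operatorname{mod}R$ means a nonempty full subcategory that is closed under isomorphisms. It is called IKE-closed if it is closed under images and kernels (of homomorphisms between its objects) and under extensions, and torsionfree if it is closed under submodules and extensions. For $M\in\operatorname{mod}R$ let $\operatorname{ext}_RM$ be the smallest subcategory of $\operatorname{mod}R$ that contains $M$ and is closed under direct summands and extensions. Let $\operatorname{fl}R$ and $\operatorname{tf}R$ be the subcategories of modules of finite length and of finitely generated torsionfree modules (those on which every non-zero-divisor of $R$ acts injectively), and let $0$ be the subcategory of zero modules. Then: 1. $\operatorname{ext}_R(R/\mathfrak{c})=\operatorname{fl}R$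 if $b>1$, and $\operatorname{ext}_R\mathfrak{c}=\operatorname{tf}R$ (for every $b>0$). 2. A subcategory of $\operatorname{mod}R$ is IKE-closed if and only if it is one of $0$, $\operatorname{fl}R$, $\operatorname{tf}R$, $\operatorname{mod}R$. In particular, every IKE-closed subcategory of $\operatorname{mod}R$ is torsionfree. -/

import Mathlib

open CategoryTheory

universe u

section Rings

/-- The formal power series `∑ cₙ tⁿ` over `k` whose exponents all lie in the semigroup `H`,
as a `k`-subalgebra of `k⟦t⟧`. -/
def numericalSemigroupSubalgebra (k : Type u) [Field k] (H : AddSubmonoid ℕ) :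
    Subalgebra k (PowerSeries k) where
  carrier := {f | ∀ n, n ∉ H → PowerSeries.coeff n f = 0}
  mul_mem' := by
    intro f g hf hg n hn
    rw [PowerSeries.coeff_mul]
    refine Finset.sum_eq_zero fun p hp => ?_
    have hp' : p.1 + p.2 = n := by simpa using hp
    by_cases h1 : p.1 ∈ H
    · by_cases h2 : p.2 ∈ H
      · exact absurd (hp' ▸ H.add_mem h1 h2) hn
      · rw [hg _ h2, mul_zero]
    · rw [hf _ h1, zero_mul]
  add_mem' := by
    intro f g hf hg n hn
    rw [map_add, hf n hn, hg n hn, add_zero]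
  algebraMap_mem' := by
    intro r n hn
    have h0 : n ≠ 0 := fun h => hn (h ▸ H.zero_mem)
    rw [PowerSeries.algebraMap_apply, PowerSeries.coeff_C]
    simp [h0]

/-- The (complete) numerical semigroup ring `k⟦H⟧`. -/
def NumericalSemigroupRing (k : Type u) [Field k] (H : AddSubmonoid ℕ) : Type u :=
  numericalSemigroupSubalgebra k H

noncomputable instance (k : Type u) [Field k] (H : AddSubmonoid ℕ) :
    CommRing (NumericalSemigroupRing k H) :=
  inferInstanceAs (CommRing (numericalSemigroupSubalgebra k H))

/-- The conductor `R :_Q S = {q ∈ Q | q S ⊆ R}` of a ring `R`, where `Q` is the total quotient ring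
of `R` and `S` is the integral closure of `R` in `Q`. As `1 ∈ S`, the set `R :_Q S` lies in `R`; it
is regarded here as an ideal of `R`. -/
noncomputable def conductorIdeal (R : Type u) [CommRing R] : Ideal R :=
  ((1 : Submodule R (FractionRing R)) /
    Subalgebra.toSubmodule (integralClosure R (FractionRing R))).comap
      (Algebra.linearMap R (FractionRing R))

end Rings

section Subcategories

variable {R : Type u} [CommRing R]

/-- The zero subcategory. -/
def zeroCat (R : Type u) [CommRing R] : ObjectProperty (ModuleCat.{u} R) :=
  fun M => Subsingleton M

/-- `fl R`: the modules of finite length. -/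
def flCat (R : Type u) [CommRing R] : ObjectProperty (ModuleCat.{u} R) :=
  fun M => IsFiniteLength R M

/-- `tf R`: the finitely generated torsionfree modules. -/
def tfCat (R : Type u) [CommRing R] : ObjectProperty (ModuleCat.{u} R) :=
  fun M => Module.Finite R M ∧ Module.IsTorsionFree R M

/-- `X` is a (nonempty, strictly full) subcategory of `mod R`, the category of finitely generated
`R`-modules. -/
structure IsModSubcategory (X : ObjectProperty (ModuleCat.{u} R)) : Prop where
  nonempty : X.Nonempty
  le_mod : X ≤ ModuleCat.isFG R
  iso_closed : X.IsClosedUnderIsomorphisms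

/-- `X` is closed under images of homomorphisms between its objects. -/
def ClosedUnderImages (X : ObjectProperty (ModuleCat.{u} R)) : Prop :=
  ∀ ⦃M N : ModuleCat.{u} R⦄ (f : M ⟶ N), X M → X N → X (ModuleCat.of R (LinearMap.range f.hom))

/-- `X` is closed under direct summands. -/
def ClosedUnderSummands (X : ObjectProperty (ModuleCat.{u} R)) : Prop :=
  ∀ ⦃M N L : ModuleCat.{u} R⦄, Nonempty (M ≃ₗ[R] N × L) → X M → X N

/-- `X` is an IKE-closed subcategory of `mod R`: it is closed under images, kernels and
extensions. -/
structure IsIKEClosed (X : ObjectProperty (ModuleCat.{u} R)) : Prop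
    extends IsModSubcategory X where
  images : ClosedUnderImages X
  kernels : X.IsClosedUnderKernels
  extensions : X.IsClosedUnderExtensions

/-- `X` is a torsionfree subcategory of `mod R`: it is closed under subobjects and extensions. -/
structure IsTorsionfreeSubcategory (X : ObjectProperty (ModuleCat.{u} R)) : Prop
    extends IsModSubcategory X where
  subobjects : X.IsClosedUnderSubobjects
  extensions : X.IsClosedUnderExtensions

/-- The extension closure `ext_R M` of a finitely generated module `M`: the smallest subcategory
of `mod R` that contains `M` and is closed under direct summands and extensions. -/
def extClosure (M : ModuleCat.{u} R) : ObjectProperty (ModuleCat.{u} R) :=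
  fun N => ∀ X : ObjectProperty (ModuleCat.{u} R), IsModSubcategory X → X M →
    ClosedUnderSummands X → X.IsClosedUnderExtensions → X N

end Subcategories

/-! ### Closure properties of subcategories of `mod R`. -/

section ModuleSubcategories

variable {R : Type u} [CommRing R] {X : ObjectProperty (ModuleCat.{u} R)}

/-! Put S = k⟦t⟧. As gcd(a, b) = 1, R contains t^c S for some c, and the classification uses only
this: R is a Noetherian local domain with R/rR of finite length for every r ≠ 0, and S is a finite
R-module.

Let 𝒳 be IKE-closed. If M ∈ 𝒳 has infinite length and r ≠ 0 kills its torsion, the image rM is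
nonzero and torsionfree. A finitely generated torsionfree module N embeds in some Sⁿ with t^e Sⁿ
inside it, so t^e S·N is the image of a map from a power of N to N; it is free over S, whence S ∈ 𝒳
(`objectProperty_powerSeries_of_isTorsionFree`). Extensions and summands then build all of tf R from
S, along the t-adic filtration of Sⁿ (`objectProperty_of_isTorsionFree`). If M ∈ 𝒳 is not
torsionfree, it has a simple submodule and a simple quotient, both the residue field, which is thus
an image of M → M; hence fl R ⊆ 𝒳. When both happen, the torsion sequence gives mod R.

For the extension closures, the conductor is t^c S ≅ S with c least, so it generates tf R as above.
For R/𝔠, let I_N be the elements of order at least N and e the least nonzero element of H. Then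
R/I_{N-e} is a summand of a self-extension of R/I_N (`quotient_orderIdeal_sub_mem`); repeating this
from N = c, which is nonzero when b > 1, reaches the residue field. -/

theorem CategoryTheory.ObjectProperty.of_exact [X.IsClosedUnderExtensions]
    {A B C : Type u} [AddCommGroup A] [Module R A] [AddCommGroup B] [Module R B] [AddCommGroup C]
    [Module R C] (f : A →ₗ[R] B) (g : B →ₗ[R] C) (hf : Function.Injective f)
    (hg : Function.Surjective g) (hfg : Function.Exact f g)
    (hA : X (ModuleCat.of R A)) (hC : X (ModuleCat.of R C)) : X (ModuleCat.of R B) := by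
  let S : ShortComplex (ModuleCat.{u} R) :=
    ShortComplex.mk (ModuleCat.ofHom f) (ModuleCat.ofHom g) (by
      ext x
      exact hfg.apply_apply_eq_zero x)
  have hS : S.ShortExact :=
    { exact := (ShortComplex.ShortExact.moduleCat_exact_iff_function_exact S).mpr hfg
      mono_f := (ModuleCat.mono_iff_injective _).mpr hf
      epi_g := (ModuleCat.epi_iff_surjective _).mpr hg }
  exact X.prop_X₂_of_shortExact hS hA hC

theorem CategoryTheory.ObjectProperty.of_quotient [X.IsClosedUnderExtensions]
    {B : Type u} [AddCommGroup B] [Module R B] (N : Submodule R B)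
    (hA : X (ModuleCat.of R N)) (hC : X (ModuleCat.of R (B ⧸ N))) : X (ModuleCat.of R B) :=
  ObjectProperty.of_exact N.subtype N.mkQ N.injective_subtype N.mkQ_surjective
    (LinearMap.exact_subtype_mkQ N) hA hC

theorem CategoryTheory.ObjectProperty.of_linearEquiv [X.IsClosedUnderIsomorphisms]
    {A B : Type u} [AddCommGroup A] [Module R A] [AddCommGroup B] [Module R B] (e : A ≃ₗ[R] B)
    (hA : X (ModuleCat.of R A)) : X (ModuleCat.of R B) :=
  X.prop_of_iso e.toModuleIso hA

theorem ClosedUnderSummands.fst (hs : ClosedUnderSummands X) {A B : Type u} [AddCommGroup A]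
    [Module R A] [AddCommGroup B] [Module R B] (h : X (ModuleCat.of R (A × B))) :
    X (ModuleCat.of R A) :=
  hs (N := ModuleCat.of R A) (L := ModuleCat.of R B) ⟨LinearEquiv.refl R _⟩ h

theorem ClosedUnderSummands.snd (hs : ClosedUnderSummands X) {A B : Type u} [AddCommGroup A]
    [Module R A] [AddCommGroup B] [Module R B] (h : X (ModuleCat.of R (A × B))) :
    X (ModuleCat.of R B) :=
  hs (N := ModuleCat.of R B) (L := ModuleCat.of R A) ⟨LinearEquiv.prodComm R _ _⟩ h

theorem ClosedUnderSummands.of_subsingleton (hs : ClosedUnderSummands X)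
    (hne : X.Nonempty) (A : Type u) [AddCommGroup A] [Module R A] [Subsingleton A] :
    X (ModuleCat.of R A) := by
  obtain ⟨M, hM⟩ := hne
  refine hs (N := ModuleCat.of R A) (L := M) ⟨?_⟩ hM
  letI : Unique A := ⟨⟨0⟩, fun a => Subsingleton.elim a 0⟩
  exact (LinearEquiv.uniqueProd (R := R) (M := M) (M₂ := A)).symm

theorem CategoryTheory.ObjectProperty.prod_mem [X.IsClosedUnderExtensions]
    {A B : Type u} [AddCommGroup A] [Module R A] [AddCommGroup B] [Module R B]
    (hA : X (ModuleCat.of R A)) (hB : X (ModuleCat.of R B)) : X (ModuleCat.of R (A × B)) :=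
  ObjectProperty.of_exact (LinearMap.inl R A B) (LinearMap.snd R A B) LinearMap.inl_injective
    LinearMap.snd_surjective Function.Exact.inl_snd hA hB

theorem CategoryTheory.ObjectProperty.pi_mem [X.IsClosedUnderExtensions]
    [X.IsClosedUnderIsomorphisms] {A : Type u} [AddCommGroup A] [Module R A]
    (h0 : X (ModuleCat.of R PUnit.{u + 1})) (hA : X (ModuleCat.of R A)) (n : ℕ) :
    X (ModuleCat.of R (Fin n → A)) := by
  induction n with
  | zero =>
    exact ObjectProperty.of_linearEquiv (0 : PUnit.{u + 1} ≃ₗ[R] (Fin 0 → A)) h0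
  | succ n ih =>
    exact ObjectProperty.of_linearEquiv (Fin.consLinearEquiv R (fun _ : Fin (n + 1) => A))
      (ObjectProperty.prod_mem hA ih)

theorem isClosedUnderSubobjects_of_injective
    (h : ∀ ⦃M N : ModuleCat.{u} R⦄ (f : M →ₗ[R] N), Function.Injective f → X N → X M) :
    X.IsClosedUnderSubobjects :=
  ⟨fun f _ hY => h f.hom ((ModuleCat.mono_iff_injective f).mp inferInstance) hY⟩

theorem isClosedUnderExtensions_of_exact
    (h : ∀ ⦃A B C : ModuleCat.{u} R⦄ (f : A →ₗ[R] B) (g : B →ₗ[R] C), Function.Injective f →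
      Function.Surjective g → Function.Exact f g → X A → X C → X B) :
    X.IsClosedUnderExtensions :=
  ⟨fun {S} hS h₁ h₃ => h S.f.hom S.g.hom hS.moduleCat_injective_f hS.moduleCat_surjective_g
    ((ShortComplex.ShortExact.moduleCat_exact_iff_function_exact S).mp hS.exact) h₁ h₃⟩

theorem IsTorsionfreeSubcategory.of_injective {R : Type u} [CommRing R]
    {X : ObjectProperty (ModuleCat.{u} R)} (hne : X.Nonempty)
    (hfg : X ≤ ModuleCat.isFG R)
    (hsub : ∀ ⦃M N : ModuleCat.{u} R⦄ (f : M →ₗ[R] N), Function.Injective f → X N → X M)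
    (hext : ∀ ⦃A B C : ModuleCat.{u} R⦄ (f : A →ₗ[R] B) (g : B →ₗ[R] C), Function.Injective f →
      Function.Surjective g → Function.Exact f g → X A → X C → X B) :
    IsTorsionfreeSubcategory X :=
  have := isClosedUnderSubobjects_of_injective hsub
  { nonempty := hne
    le_mod := hfg
    iso_closed := inferInstance
    subobjects := this
    extensions := isClosedUnderExtensions_of_exact hext }

theorem IsTorsionfreeSubcategory.of_injective_mem (hX : IsTorsionfreeSubcategory X)
    {M N : ModuleCat.{u} R} (f : M →ₗ[R] N) (hf : Function.Injective f) (hN : X N) : X M :=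
  have := hX.subobjects
  have : Mono (ModuleCat.ofHom f) := (ModuleCat.mono_iff_injective _).mpr hf
  X.prop_of_mono (ModuleCat.ofHom f) hN

theorem IsTorsionfreeSubcategory.closedUnderSummands (hX : IsTorsionfreeSubcategory X) :
    ClosedUnderSummands X := fun M N L ⟨e⟩ (hM : X M) =>
  hX.of_injective_mem (M := N) (N := M) (e.symm.toLinearMap ∘ₗ LinearMap.inl R N L)
    (e.symm.injective.comp LinearMap.inl_injective) hM

theorem IsTorsionfreeSubcategory.isIKEClosed (hX : IsTorsionfreeSubcategory X) :
    IsIKEClosed X :=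
  have := hX.subobjects
  { hX with
    images := fun _ _ f _ hN =>
      hX.of_injective_mem (M := ModuleCat.of R (LinearMap.range f.hom)) (Submodule.subtype _)
        (Submodule.injective_subtype _) hN
    kernels := inferInstance }

/-- `X` itself competes in the definition of the closure, so only its minimality needs an argument.
-/
theorem IsTorsionfreeSubcategory.extClosure_eq (hX : IsTorsionfreeSubcategory X)
    {M : ModuleCat.{u} R} (hM : X M)
    (h : ∀ Y : ObjectProperty (ModuleCat.{u} R), IsModSubcategory Y → Y M →
      ClosedUnderSummands Y → Y.IsClosedUnderExtensions → X ≤ Y) : extClosure M = X := by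
  refine le_antisymm (fun N hN => ?_) fun N hN Y hY hYM hYs hYe => h Y hY hYM hYs hYe N hN
  exact hN X hX.toIsModSubcategory hM hX.closedUnderSummands hX.extensions

theorem IsIKEClosed.range_mem (hX : IsIKEClosed X) {A B : Type u} [AddCommGroup A] [Module R A]
    [AddCommGroup B] [Module R B] (f : A →ₗ[R] B) (hA : X (ModuleCat.of R A))
    (hB : X (ModuleCat.of R B)) : X (ModuleCat.of R (LinearMap.range f)) :=
  hX.images (ModuleCat.ofHom f) hA hB

/-- A summand is the image of an idempotent endomorphism. -/
theorem IsIKEClosed.closedUnderSummands (hX : IsIKEClosed X) : ClosedUnderSummands X := by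
  intro M N L ⟨e⟩ hM
  have := hX.iso_closed
  have hsurj : Function.Surjective (LinearMap.fst R N L ∘ₗ e.toLinearMap) :=
    (LinearMap.fst_surjective (R := R) (M := N) (M₂ := L)).comp e.surjective
  have hinj : Function.Injective (e.symm.toLinearMap ∘ₗ LinearMap.inl R N L) :=
    e.symm.injective.comp LinearMap.inl_injective
  have hr : LinearMap.range ((e.symm.toLinearMap ∘ₗ LinearMap.inl R N L) ∘ₗ
      (LinearMap.fst R N L ∘ₗ e.toLinearMap)) =
      LinearMap.range (e.symm.toLinearMap ∘ₗ LinearMap.inl R N L) :=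
    LinearMap.range_comp_of_range_eq_top _ (LinearMap.range_eq_top.mpr hsurj)
  have h := hX.range_mem ((e.symm.toLinearMap ∘ₗ LinearMap.inl R N L) ∘ₗ
      (LinearMap.fst R N L ∘ₗ e.toLinearMap)) hM hM
  rw [hr] at h
  exact ObjectProperty.of_linearEquiv (LinearEquiv.ofInjective _ hinj).symm h

theorem isTorsionfreeSubcategory_zeroCat : IsTorsionfreeSubcategory (zeroCat R) := by
  refine .of_injective (ObjectProperty.nonempty_of_prop (X := ModuleCat.of R PUnit.{u + 1})
    (inferInstanceAs (Subsingleton PUnit.{u + 1}))) (fun M hM => ?_) ?_ ?_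
  · have : Subsingleton M := hM
    exact inferInstanceAs (Module.Finite R M)
  · intro M N f hf hN
    have : Subsingleton N := hN
    exact hf.subsingleton
  · intro A B C f g hf hg hfg hA hC
    have : Subsingleton A := hA
    have : Subsingleton C := hC
    refine ⟨fun x y => ?_⟩
    have key : ∀ x : B, x = 0 := fun x => by
      obtain ⟨a, rfl⟩ := (hfg x).mp (Subsingleton.elim _ _)
      rw [Subsingleton.elim a 0, map_zero]
    rw [key x, key y]

theorem isTorsionfreeSubcategory_flCat : IsTorsionfreeSubcategory (flCat R) := by
  refine .of_injective (ObjectProperty.nonempty_of_prop (X := ModuleCat.of R PUnit.{u + 1})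
    (.of_subsingleton (M := PUnit.{u + 1}))) (fun M hM => ?_)
    (fun M N f hf hN => hN.of_injective hf) ?_
  · have := (isFiniteLength_iff_isNoetherian_isArtinian.mp hM).1
    exact inferInstanceAs (Module.Finite R M)
  · intro A B C f g hf hg hfg hA hC
    obtain ⟨_, _⟩ := isFiniteLength_iff_isNoetherian_isArtinian.mp hA
    obtain ⟨_, _⟩ := isFiniteLength_iff_isNoetherian_isArtinian.mp hC
    have hker : LinearMap.range f = LinearMap.ker g := (LinearMap.exact_iff.mp hfg).symm
    exact isFiniteLength_iff_isNoetherian_isArtinian.mpr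
      ⟨isNoetherian_of_range_eq_ker f g hker, isArtinian_of_range_eq_ker f g hker⟩

theorem isTorsionfreeSubcategory_isFG [IsNoetherianRing R] :
    IsTorsionfreeSubcategory (ModuleCat.isFG R) := by
  refine .of_injective (ObjectProperty.nonempty_of_prop (X := ModuleCat.of R PUnit.{u + 1})
    (inferInstanceAs (Module.Finite R PUnit.{u + 1}))) le_rfl ?_ ?_
  · intro M N f hf hN
    have : Module.Finite R N := hN
    exact Module.Finite.of_injective f hf
  · intro A B C f g hf hg hfg hA hC
    have : Module.Finite R A := hA
    have : Module.Finite R C := hC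
    have hker : LinearMap.range f = LinearMap.ker g := (LinearMap.exact_iff.mp hfg).symm
    have := isNoetherian_of_range_eq_ker f g hker
    exact inferInstanceAs (Module.Finite R B)

theorem isTorsionfreeSubcategory_tfCat [IsNoetherianRing R] :
    IsTorsionfreeSubcategory (tfCat R) := by
  refine .of_injective (ObjectProperty.nonempty_of_prop (X := ModuleCat.of R PUnit.{u + 1})
    ⟨inferInstanceAs (Module.Finite R PUnit.{u + 1}),
      inferInstanceAs (Module.IsTorsionFree R PUnit.{u + 1})⟩)
    (fun M hM => hM.1) ?_ ?_
  · intro M N f hf hN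
    refine ⟨isTorsionfreeSubcategory_isFG.of_injective_mem f hf hN.1, ?_⟩
    have := hN.2
    exact hf.moduleIsTorsionFree f (map_smul f)
  · intro A B C f g hf hg hfg hA hC
    have := (isTorsionfreeSubcategory_isFG (R := R)).extensions
    refine ⟨ObjectProperty.of_exact (X := ModuleCat.isFG R) f g hf hg hfg hA.1 hC.1,
      ⟨fun r hr => ?_⟩⟩
    have := hA.2
    have := hC.2
    refine isSMulRegular_iff_right_eq_zero_of_smul.mpr fun x hx => ?_
    have hgx : g x = 0 := hr.smul_eq_zero_iff_right.mp (by rw [← map_smul, hx, map_zero])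
    obtain ⟨a, rfl⟩ := (hfg x).mp hgx
    have : a = 0 := hr.smul_eq_zero_iff_right.mp (hf (by rw [map_smul, hx, map_zero]))
    rw [this, map_zero]

end ModuleSubcategories

/-! ### Embedding torsionfree modules in free modules. -/

/-- A maximal independent subfamily of the generators spans a free `N ≤ M`, and each generator has a
nonzero multiple in `N`. Multiplication by the product `d` of the multipliers maps `M` into `N` and
`N` onto `dN`. -/
theorem Module.IsTorsionFree.exists_injective_pi {R M : Type*} [CommRing R] [IsDomain R]
    [AddCommGroup M] [Module R M] [Module.Finite R M] [Module.IsTorsionFree R M] :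
    ∃ (n : ℕ) (f : M →ₗ[R] (Fin n → R)) (d : R), Function.Injective f ∧ d ≠ 0 ∧
      ∀ v : Fin n → R, d • v ∈ LinearMap.range f := by
  obtain ⟨m, s, hs⟩ := Module.Finite.exists_fin (R := R) (M := M)
  obtain ⟨I, hI, hmax⟩ := exists_maximal_linearIndepOn R s
  have hex : ∀ i, ∃ a : R, a ≠ 0 ∧ a • s i ∈ Submodule.span R (s '' I) := fun i => by
    by_cases hi : i ∈ I
    · exact ⟨1, one_ne_zero, by
        rw [one_smul]; exact Submodule.subset_span (Set.mem_image_of_mem s hi)⟩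
    · exact hmax i hi
  choose a ha ha' using hex
  let N := Submodule.span R (Set.range fun i : I => s i)
  have hN : Submodule.span R (s '' I) = N := by rw [Set.image_eq_range]
  let e : N ≃ₗ[R] (Fin (Nat.card I) → R) :=
    ((Module.Basis.span (R := R) (v := fun i : I => s i) hI).reindex
      (Finite.equivFin I)).equivFun
  have hA : ∏ i, a i ≠ 0 := Finset.prod_ne_zero_iff.mpr fun i _ => ha i
  have hAN : ∀ x : M, (∏ i, a i) • x ∈ N := by
    intro x
    have hx : x ∈ Submodule.span R (Set.range s) := hs ▸ Submodule.mem_top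
    induction hx using Submodule.span_induction with
    | mem x hx =>
      obtain ⟨i, rfl⟩ := hx
      classical
      rw [Fintype.prod_eq_prod_compl_mul i, mul_smul, ← hN]
      exact Submodule.smul_mem _ _ (ha' i)
    | zero => rw [smul_zero]; exact N.zero_mem
    | add x y _ _ hx hy => rw [smul_add]; exact N.add_mem hx hy
    | smul r x _ hx => rw [smul_comm]; exact N.smul_mem r hx
  refine ⟨_, e.toLinearMap ∘ₗ (LinearMap.lsmul R M (∏ i, a i)).codRestrict N hAN, ∏ i, a i,
    e.injective.comp fun x y hxy => ?_, hA, fun v => ⟨(e.symm v : N), ?_⟩⟩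
  · exact smul_right_injective M hA (congrArg Subtype.val hxy)
  · have : (LinearMap.lsmul R M (∏ i, a i)).codRestrict N hAN (e.symm v : N) =
        (∏ i, a i) • e.symm v := Subtype.ext rfl
    rw [LinearMap.comp_apply, this, LinearEquiv.coe_coe, map_smul, e.apply_symm_apply]

/-! ### Ring theory of subalgebras of k⟦X⟧ of finite colength. -/

section PowerSeriesOrder

open PowerSeries

variable {k : Type u} [Field k] {R : Type u} [CommRing R] [Algebra R k⟦X⟧] {c : ℕ}

theorem PowerSeries.exists_eq_X_pow_mul_isUnit {f : k⟦X⟧} (hf : f ≠ 0) :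
    ∃ (n : ℕ) (u : k⟦X⟧), IsUnit u ∧ f = X ^ n * u := by
  obtain ⟨n, hn⟩ := IsDiscreteValuationRing.associated_pow_irreducible hf X_irreducible
  obtain ⟨u, hu⟩ := hn.symm
  exact ⟨n, u, u.isUnit, hu.symm⟩

/-! Throughout, `R` is a `k`-subalgebra of `k⟦X⟧` that contains all multiples of `X ^ c`. -/

namespace PowerSeriesOrder

theorem isDomain (R k : Type u) [Field k] [CommRing R] [Algebra R k⟦X⟧] [FaithfulSMul R k⟦X⟧] :
    IsDomain R :=
  (FaithfulSMul.algebraMap_injective R k⟦X⟧).isDomain (algebraMap R k⟦X⟧)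

/-- If r = Xⁿu with u a unit, dividing a multiple of X^(n+c) by r leaves a multiple of X^c, which
lies in `R`. -/
theorem exists_algebraMap_mul_eq [FaithfulSMul R k⟦X⟧]
    (hc : ∀ f : k⟦X⟧, X ^ c ∣ f → f ∈ (algebraMap R k⟦X⟧).range) {r : R} (hr : r ≠ 0) :
    ∃ n : ℕ, ∀ f : k⟦X⟧, X ^ n ∣ f → ∃ q, algebraMap R k⟦X⟧ (r * q) = f := by
  obtain ⟨n, u, hu, hru⟩ := PowerSeries.exists_eq_X_pow_mul_isUnit
    ((map_ne_zero_iff _ (FaithfulSMul.algebraMap_injective R k⟦X⟧)).mpr hr)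
  obtain ⟨v, huv⟩ := hu.exists_right_inv
  refine ⟨n + c, fun f ⟨g, hg⟩ => ?_⟩
  obtain ⟨q, hq⟩ := hc (X ^ c * (v * g)) (Dvd.intro _ rfl)
  refine ⟨q, ?_⟩
  rw [map_mul, hq, hg, hru]
  linear_combination (X ^ (n + c) * g) * huv

variable [Algebra k R] [IsScalarTower k R k⟦X⟧]

/-- The powers 1, X, …, X^c generate: below order `c`, peel off one leading term at a time, its
coefficient being a scalar from k ⊆ R. -/
theorem finite_powerSeries (hc : ∀ f : k⟦X⟧, X ^ c ∣ f → f ∈ (algebraMap R k⟦X⟧).range) :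
    Module.Finite R k⟦X⟧ := by
  classical
  refine ⟨⟨(Finset.range (c + 1)).image fun i => (X : k⟦X⟧) ^ i, ?_⟩⟩
  rw [eq_top_iff]
  set N := Submodule.span R
      (((Finset.range (c + 1)).image fun i => (X : k⟦X⟧) ^ i : Finset k⟦X⟧) : Set k⟦X⟧)
  have hX : ∀ i ≤ c, (X : k⟦X⟧) ^ i ∈ N := fun i hi =>
    Submodule.subset_span (by simpa using ⟨i, by lia, rfl⟩)
  have key : ∀ j ≤ c, ∀ f : k⟦X⟧, X ^ (c - j) ∣ f → f ∈ N := by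
    intro j
    induction j with
    | zero =>
      intro _ f hf
      obtain ⟨r, rfl⟩ := hc f hf
      simpa [Algebra.smul_def] using N.smul_mem r (hX 0 (by lia))
    | succ j ih =>
      rintro hj _ ⟨g, rfl⟩
      rw [eq_X_mul_shift_add_const g, mul_add]
      refine Submodule.add_mem _ (ih (by lia) _ ?_) ?_
      · rw [← mul_assoc, ← pow_succ, show c - (j + 1) + 1 = c - j by lia]
        exact Dvd.intro _ rfl
      · have := N.smul_mem (algebraMap k R (constantCoeff g)) (hX (c - (j + 1)) (by lia))
        rwa [Algebra.smul_def, ← IsScalarTower.algebraMap_apply, mul_comm] at this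
  intro f _
  exact key c le_rfl f (by simp)

variable [FaithfulSMul R k⟦X⟧]

/-- The ideal rR contains every element of `R` of large order, so R/rR is a quotient of a space of
truncated series. -/
theorem finite_quotient_span_singleton
    (hc : ∀ f : k⟦X⟧, X ^ c ∣ f → f ∈ (algebraMap R k⟦X⟧).range) {r : R}
    (hr : r ≠ 0) : Module.Finite k (R ⧸ Ideal.span {r}) := by
  obtain ⟨n, hn⟩ := exists_algebraMap_mul_eq hc hr
  let φ : R →ₗ[k] (Fin n → k) :=
    LinearMap.pi fun i => coeff (i : ℕ) ∘ₗ (IsScalarTower.toAlgHom k R k⟦X⟧).toLinearMap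
  have hφ : LinearMap.ker φ ≤
      LinearMap.ker (Ideal.Quotient.mkₐ k (Ideal.span {r})).toLinearMap := by
    intro s hs
    obtain ⟨q, hq⟩ := hn (algebraMap R k⟦X⟧ s)
      (X_pow_dvd_iff.mpr fun m hm => congrFun hs ⟨m, hm⟩)
    exact Ideal.Quotient.eq_zero_iff_mem.mpr (Ideal.mem_span_singleton.mpr
      ⟨q, FaithfulSMul.algebraMap_injective R k⟦X⟧ hq.symm⟩)
  have : Module.Finite k (R ⧸ LinearMap.ker φ) :=
    Module.Finite.equiv φ.quotKerEquivRange.symm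
  refine Module.Finite.of_surjective ((LinearMap.ker φ).liftQ _ hφ) ?_
  rw [← LinearMap.range_eq_top, Submodule.range_liftQ, LinearMap.range_eq_top]
  exact Ideal.Quotient.mkₐ_surjective k _

theorem isFiniteLength_quotient_span_singleton
    (hc : ∀ f : k⟦X⟧, X ^ c ∣ f → f ∈ (algebraMap R k⟦X⟧).range)
    {r : R} (hr : r ≠ 0) : IsFiniteLength R (R ⧸ Ideal.span {r}) := by
  have := finite_quotient_span_singleton hc hr
  exact isFiniteLength_iff_isNoetherian_isArtinian.mpr
    ⟨isNoetherian_of_tower k inferInstance, isArtinian_of_tower k inferInstance⟩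

theorem isNoetherianRing (hc : ∀ f : k⟦X⟧, X ^ c ∣ f → f ∈ (algebraMap R k⟦X⟧).range) :
    IsNoetherianRing R := by
  rw [isNoetherianRing_iff_ideal_fg]
  intro I
  by_cases hI : I = ⊥
  · rw [hI]; exact Submodule.fg_bot
  obtain ⟨r, hrI, hr⟩ := Submodule.exists_mem_ne_zero_of_ne_bot hI
  have := (isFiniteLength_iff_isNoetherian_isArtinian.mp
    (isFiniteLength_quotient_span_singleton hc hr)).1
  refine Submodule.fg_of_fg_map_of_fg_inf_ker (Ideal.span {r}).mkQ
    (IsNoetherian.noetherian _) ?_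
  rw [Submodule.ker_mkQ, inf_eq_right.mpr ((Ideal.span_singleton_le_iff_mem I).mpr hrI)]
  exact ⟨{r}, by simp [Ideal.submodule_span_eq]⟩

/-- A finite extension is integral, so it reflects units. -/
theorem isLocalHom_algebraMap
    (hc : ∀ f : k⟦X⟧, X ^ c ∣ f → f ∈ (algebraMap R k⟦X⟧).range) :
    IsLocalHom (algebraMap R k⟦X⟧) :=
  have := finite_powerSeries hc
  inferInstance

theorem isLocalRing (hc : ∀ f : k⟦X⟧, X ^ c ∣ f → f ∈ (algebraMap R k⟦X⟧).range) :
    IsLocalRing R :=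
  have := isLocalHom_algebraMap hc
  RingHom.domain_isLocalRing (algebraMap R k⟦X⟧)

/-- `M` is a finitely generated module over the Artinian ring R/rR. -/
theorem isFiniteLength_of_smul_eq_zero
    (hc : ∀ f : k⟦X⟧, X ^ c ∣ f → f ∈ (algebraMap R k⟦X⟧).range) {r : R} (hr : r ≠ 0)
    {M : Type*} [AddCommGroup M] [Module R M] [Module.Finite R M]
    (hM : ∀ x : M, r • x = 0) : IsFiniteLength R M := by
  have := isNoetherianRing hc
  obtain ⟨_, _⟩ := isFiniteLength_iff_isNoetherian_isArtinian.mp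
    (isFiniteLength_quotient_span_singleton hc hr)
  have htors : Module.IsTorsionBySet R M (Ideal.span {r} : Set R) :=
    (Module.isTorsionBySet_span_singleton_iff r).mpr fun x => hM x
  let _ := htors.module
  have := htors.isScalarTower (S := R)
  have hsurj : Function.Surjective (algebraMap R (R ⧸ Ideal.span {r})) :=
    Ideal.Quotient.mk_surjective
  have : IsArtinianRing (R ⧸ Ideal.span {r}) := isArtinian_of_tower R inferInstance
  have : Module.Finite (R ⧸ Ideal.span {r}) M := Module.Finite.of_restrictScalars_finite R _ M
  exact isFiniteLength_iff_isNoetherian_isArtinian.mpr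
    ⟨inferInstance, isArtinian_of_surjective_algebraMap hsurj⟩

end PowerSeriesOrder

end PowerSeriesOrder

/-! ### The sequence 0 → A ∩ P → A × P → A + P → 0 and lattices over a principal ideal domain. -/

section

variable {R : Type u} [CommRing R] {X : ObjectProperty (ModuleCat.{u} R)}

theorem Submodule.objectProperty_inf_sup [X.IsClosedUnderExtensions] {F : Type u} [AddCommGroup F]
    [Module R F] (A P : Submodule R F) (hinf : X (ModuleCat.of R (A ⊓ P : Submodule R F)))
    (hsup : X (ModuleCat.of R (A ⊔ P : Submodule R F))) : X (ModuleCat.of R (A × P)) := by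
  refine ObjectProperty.of_exact
    ((Submodule.inclusion (inf_le_left : A ⊓ P ≤ A)).prod (Submodule.inclusion inf_le_right))
    ((Submodule.inclusion (le_sup_left : A ≤ A ⊔ P)).coprod
      (-Submodule.inclusion (le_sup_right : P ≤ A ⊔ P))) ?_ ?_ ?_ hinf hsup
  · intro x y hxy
    exact Subtype.ext (congrArg (fun z : A × P => (z.1 : F)) hxy)
  · rintro ⟨x, hx⟩
    obtain ⟨a, ha, p, hp, rfl⟩ := Submodule.mem_sup.mp hx
    exact ⟨(⟨a, ha⟩, ⟨-p, P.neg_mem hp⟩), Subtype.ext (by simp)⟩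
  · rintro ⟨a, p⟩
    constructor
    · intro h
      have h' : (a : F) + -p = 0 := congrArg Subtype.val h
      have hap : (a : F) = p := by rwa [← sub_eq_add_neg, sub_eq_zero] at h'
      exact ⟨⟨a, a.2, hap ▸ p.2⟩, Prod.ext rfl (Subtype.ext hap)⟩
    · rintro ⟨x, hx⟩
      rw [← hx]
      exact Subtype.ext (by simp)

theorem Submodule.objectProperty_of_isPrincipalIdealRing [X.IsClosedUnderExtensions]
    [X.IsClosedUnderIsomorphisms] {S : Type u} [CommRing S] [IsDomain S] [IsPrincipalIdealRing S]
    [Algebra R S] (h0 : X (ModuleCat.of R PUnit.{u + 1})) (hS : X (ModuleCat.of R S)) {n : ℕ}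
    (L : Submodule S (Fin n → S)) : X (ModuleCat.of R L) := by
  obtain ⟨m, b⟩ := Submodule.basisOfPid (Pi.basisFun S (Fin n)) L
  exact ObjectProperty.of_linearEquiv (b.equivFun.restrictScalars R).symm
    (ObjectProperty.pi_mem h0 hS m)

theorem ClosedUnderSummands.of_submodule_isPrincipalIdealRing [X.IsClosedUnderIsomorphisms]
    (hX : ClosedUnderSummands X) {S : Type u} [CommRing S] [IsDomain S] [IsPrincipalIdealRing S]
    [Algebra R S] {n : ℕ} (L : Submodule S (Fin n → S)) (hL0 : L ≠ ⊥)
    (hL : X (ModuleCat.of R L)) : X (ModuleCat.of R S) := by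
  obtain ⟨m, b⟩ := Submodule.basisOfPid (Pi.basisFun S (Fin n)) L
  cases m with
  | zero =>
    exact absurd ((Submodule.eq_bot_iff L).mpr fun x hx => by
      simpa using b.ext_elem (x := ⟨x, hx⟩) (y := 0) fun i => i.elim0) hL0
  | succ m =>
    exact hX.fst (ObjectProperty.of_linearEquiv ((b.equivFun.restrictScalars R).trans
      (Fin.consLinearEquiv R (fun _ : Fin (m + 1) => S)).symm) hL)

end

/-! ### Torsionfree modules as lattices in k⟦X⟧ⁿ. -/

namespace PowerSeriesOrder

open PowerSeries

variable {k : Type u} [Field k] {R : Type u} [CommRing R] [Algebra R k⟦X⟧] {c : ℕ}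
  {𝒳 : ObjectProperty (ModuleCat.{u} R)}

theorem exists_injective_pi_powerSeries [FaithfulSMul R k⟦X⟧]
    (hc : ∀ f : k⟦X⟧, X ^ c ∣ f → f ∈ (algebraMap R k⟦X⟧).range)
    {M : Type*} [AddCommGroup M] [Module R M] [Module.Finite R M] [Module.IsTorsionFree R M] :
    ∃ (n e : ℕ) (f : M →ₗ[R] (Fin n → k⟦X⟧)), Function.Injective f ∧
      ∀ w : Fin n → k⟦X⟧, (X : k⟦X⟧) ^ e • w ∈ LinearMap.range f := by
  have := isDomain R k
  obtain ⟨n, f, d, hf, hd, hdf⟩ := Module.IsTorsionFree.exists_injective_pi (R := R) (M := M)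
  obtain ⟨e, he⟩ := exists_algebraMap_mul_eq hc hd
  have hinj := FaithfulSMul.algebraMap_injective R k⟦X⟧
  let ι : (Fin n → R) →ₗ[R] (Fin n → k⟦X⟧) := (Algebra.linearMap R k⟦X⟧).compLeft (Fin n)
  have hι : Function.Injective ι := fun x y hxy => funext fun i => hinj (congrFun hxy i)
  refine ⟨n, e, ι ∘ₗ f, hι.comp hf, fun w => ?_⟩
  choose q hq using fun i => he (X ^ e * w i) (Dvd.intro _ rfl)
  obtain ⟨x, hx⟩ := hdf q
  refine ⟨x, funext fun i => ?_⟩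
  rw [LinearMap.comp_apply, hx]
  exact hq i

variable [Algebra k R] [IsScalarTower k R k⟦X⟧]

/-- `L` lies between Xⁱ⁺¹k⟦X⟧ⁿ and Xⁱk⟦X⟧ⁿ. Modulo the smaller one, `s` acts through its constant
term, which comes from `R`. -/
theorem smul_mem_of_X_pow_smul_mem {n i : ℕ} (L : Submodule R (Fin n → k⟦X⟧))
    (h₁ : ∀ v ∈ L, ∃ w, v = (X : k⟦X⟧) ^ i • w) (h₂ : ∀ w, (X : k⟦X⟧) ^ (i + 1) • w ∈ L)
    (s : k⟦X⟧) {v : Fin n → k⟦X⟧} (hv : v ∈ L) : s • v ∈ L := by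
  obtain ⟨w, hw⟩ := h₁ v hv
  rw [eq_X_mul_shift_add_const s, add_smul]
  refine L.add_mem ?_ ?_
  · convert h₂ ((PowerSeries.mk fun p ↦ coeff (p + 1) s) • w) using 1
    rw [hw, smul_smul, smul_smul]
    congr 1
    ring
  · have := L.smul_mem (algebraMap k R (constantCoeff s)) hv
    rwa [← algebraMap_smul k⟦X⟧, ← IsScalarTower.algebraMap_apply] at this

/-- The modules `M ∩ Xⁱ k⟦X⟧ⁿ` are obtained from free `k⟦X⟧`-modules by descending induction on `i`,
through `0 → A ∩ P → A × P → A + P → 0` with `A = M ∩ Xⁱ k⟦X⟧ⁿ` and `P = Xⁱ⁺¹ k⟦X⟧ⁿ`. -/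
theorem objectProperty_of_isTorsionFree [FaithfulSMul R k⟦X⟧]
    (hc : ∀ f : k⟦X⟧, X ^ c ∣ f → f ∈ (algebraMap R k⟦X⟧).range)
    (h𝒳 : IsModSubcategory 𝒳) (hs : ClosedUnderSummands 𝒳) [𝒳.IsClosedUnderExtensions]
    (hS : 𝒳 (ModuleCat.of R k⟦X⟧)) (M : Type u) [AddCommGroup M] [Module R M] [Module.Finite R M]
    [Module.IsTorsionFree R M] : 𝒳 (ModuleCat.of R M) := by
  have := h𝒳.iso_closed
  have h0 := hs.of_subsingleton h𝒳.nonempty PUnit.{u + 1}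
  obtain ⟨n, e, f, hf, hfe⟩ := exists_injective_pi_powerSeries hc (M := M)
  refine ObjectProperty.of_linearEquiv (LinearEquiv.ofInjective f hf).symm ?_
  let T : ℕ → Submodule k⟦X⟧ (Fin n → k⟦X⟧) := fun i =>
    LinearMap.range (LinearMap.lsmul k⟦X⟧ (Fin n → k⟦X⟧) (X ^ i))
  have hT : ∀ i w, (X : k⟦X⟧) ^ i • w ∈ T i := fun i w => ⟨w, rfl⟩
  have hTanti : Antitone T := antitone_nat_of_succ_le fun i => by
    rintro _ ⟨w, rfl⟩
    refine ⟨(X : k⟦X⟧) • w, ?_⟩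
    simp only [LinearMap.lsmul_apply]
    rw [smul_smul, pow_succ]
  set N := LinearMap.range f
  have hTe : (T e).restrictScalars R ≤ N := by
    rintro _ ⟨w, rfl⟩
    exact hfe w
  have key : ∀ j ≤ e, 𝒳 (ModuleCat.of R (N ⊓ (T (e - j)).restrictScalars R :
      Submodule R (Fin n → k⟦X⟧))) := by
    intro j
    induction j with
    | zero =>
      intro _
      rw [Nat.sub_zero, inf_eq_right.mpr hTe]
      exact Submodule.objectProperty_of_isPrincipalIdealRing h0 hS (T e)
    | succ j ih =>
      intro hj
      obtain ⟨i, rfl⟩ : ∃ i, e = i + (j + 1) := ⟨e - (j + 1), by lia⟩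
      have ih := ih (by lia)
      rw [show i + (j + 1) - j = i + 1 by lia] at ih
      rw [Nat.add_sub_cancel]
      have hle : T (i + 1) ≤ T i := hTanti (by lia)
      set A := N ⊓ (T i).restrictScalars R with hA
      set P := (T (i + 1)).restrictScalars R
      have hAP : A ⊔ P ≤ (T i).restrictScalars R := sup_le inf_le_right hle
      -- `A ⊔ P` lies between consecutive layers, so it is stable under k⟦X⟧ and hence free.
      let L : Submodule k⟦X⟧ (Fin n → k⟦X⟧) :=
        { (A ⊔ P).toAddSubmonoid with
          smul_mem' := fun s v hv => smul_mem_of_X_pow_smul_mem (i := i) (A ⊔ P)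
            (fun v hv => by obtain ⟨w, hw⟩ := hAP hv; exact ⟨w, hw.symm⟩)
            (fun w => Submodule.mem_sup_right (hT _ w)) s hv }
      refine hs.fst (B := P) (Submodule.objectProperty_inf_sup A P ?_ ?_)
      -- `A ⊓ P` is the module of the previous stage.
      · rwa [hA, inf_assoc, inf_eq_right.mpr (show P ≤ (T i).restrictScalars R from hle)]
      · exact Submodule.objectProperty_of_isPrincipalIdealRing h0 hS L
  have h := key e le_rfl
  rwa [Nat.sub_self, inf_eq_left.mpr fun v _ => ⟨v, by simp⟩] at h

/-- Up to a power of `X`, the `k⟦X⟧`-span of `M` is the image of a map from a power of `M`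
to `M`. -/
theorem objectProperty_powerSeries_of_isTorsionFree [FaithfulSMul R k⟦X⟧]
    (hc : ∀ f : k⟦X⟧, X ^ c ∣ f → f ∈ (algebraMap R k⟦X⟧).range) (h𝒳 : IsIKEClosed 𝒳)
    (M : Type u) [AddCommGroup M] [Module R M] [Module.Finite R M] [Module.IsTorsionFree R M]
    [Nontrivial M] (hM : 𝒳 (ModuleCat.of R M)) : 𝒳 (ModuleCat.of R k⟦X⟧) := by
  have := h𝒳.iso_closed
  have := h𝒳.extensions
  have hs := h𝒳.closedUnderSummands
  have h0 := hs.of_subsingleton h𝒳.nonempty PUnit.{u + 1}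
  obtain ⟨n, e, f, hf, hfe⟩ := exists_injective_pi_powerSeries hc (M := M)
  obtain ⟨x, hx⟩ := exists_ne (0 : M)
  have := finite_powerSeries hc
  obtain ⟨m, g, hg⟩ := Module.Finite.exists_fin (R := R) (M := k⟦X⟧)
  -- The `g j` generate k⟦X⟧ over `R`, so the range is X^e times the k⟦X⟧-span of `f(M)`; the factor
  -- X^e keeps it inside `f(M)`.
  let ψ : (Fin m → M) →ₗ[R] (Fin n → k⟦X⟧) :=
    ∑ j, Algebra.lsmul R R (Fin n → k⟦X⟧) (X ^ e * g j) ∘ₗ f ∘ₗ LinearMap.proj j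
  have hψ : ∀ v, ψ v = ∑ j, (X ^ e * g j) • f (v j) := fun v => by
    rw [LinearMap.sum_apply]
    rfl
  have hψf : ∀ v, ψ v ∈ LinearMap.range f := fun v => by
    rw [hψ]
    exact Submodule.sum_mem _ fun j _ => by rw [mul_smul]; exact hfe _
  have hmem : ∀ (s : k⟦X⟧) (y : M), (X ^ e * s) • f y ∈ LinearMap.range ψ := by
    intro s y
    obtain ⟨a, rfl⟩ := (Submodule.mem_span_range_iff_exists_fun R).mp
      (hg ▸ Submodule.mem_top : s ∈ Submodule.span R (Set.range g))
    refine ⟨fun j => a j • y, ?_⟩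
    rw [hψ, Finset.mul_sum, Finset.sum_smul]
    refine Finset.sum_congr rfl fun j _ => ?_
    rw [map_smul, mul_smul_comm, smul_assoc, smul_comm]
  let L : Submodule k⟦X⟧ (Fin n → k⟦X⟧) :=
    { (LinearMap.range ψ).toAddSubmonoid with
      smul_mem' := by
        rintro s _ ⟨v, rfl⟩
        rw [hψ, Finset.smul_sum]
        refine Submodule.sum_mem (LinearMap.range ψ) fun j _ => ?_
        rw [smul_smul, mul_left_comm]
        exact hmem _ _ }
  have hL0 : L ≠ ⊥ := fun h => by
    have h1 : (X ^ e * 1 : k⟦X⟧) • f x ∈ L := hmem 1 x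
    rw [h, Submodule.mem_bot, mul_one, smul_eq_zero] at h1
    exact h1.elim (pow_ne_zero e X_ne_zero) fun h => hx (hf (h.trans (map_zero f).symm))
  refine hs.of_submodule_isPrincipalIdealRing L hL0 ?_
  -- Closure under images needs a target in `𝒳`: use `range f ≅ M` in place of k⟦X⟧ⁿ.
  let χ : (Fin m → M) →ₗ[R] LinearMap.range f := ψ.codRestrict _ hψf
  have hχ := h𝒳.range_mem χ (ObjectProperty.pi_mem h0 hM m)
    (ObjectProperty.of_linearEquiv (LinearEquiv.ofInjective f hf) hM)
  have hmap : (LinearMap.range χ).map (LinearMap.range f).subtype = LinearMap.range ψ := by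
    rw [← LinearMap.range_comp, LinearMap.subtype_comp_codRestrict]
  have := ObjectProperty.of_linearEquiv (Submodule.equivMapOfInjective (LinearMap.range f).subtype
    (Submodule.injective_subtype _) (LinearMap.range χ)) hχ
  rw [hmap] at this
  exact this

end PowerSeriesOrder

/-! ### Finite length modules over a local ring. -/

section LocalRing

variable {R : Type u} [CommRing R] [IsLocalRing R] {X : ObjectProperty (ModuleCat.{u} R)}

theorem IsSimpleModule.nonempty_linearEquiv_quotient_maximalIdeal (M : Type*) [AddCommGroup M]
    [Module R M] [IsSimpleModule R M] : Nonempty (M ≃ₗ[R] R ⧸ IsLocalRing.maximalIdeal R) := by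
  obtain ⟨I, hI, he⟩ := isSimpleModule_iff_quot_maximal.mp (inferInstance : IsSimpleModule R M)
  rwa [IsLocalRing.eq_maximalIdeal hI] at he

theorem flCat_le_of_quotient_maximalIdeal (hX : IsModSubcategory X) (hs : ClosedUnderSummands X)
    [X.IsClosedUnderExtensions] (hk : X (ModuleCat.of R (R ⧸ IsLocalRing.maximalIdeal R))) :
    flCat R ≤ X := by
  have := hX.iso_closed
  have key : ∀ (M : Type u) [AddCommGroup M] [Module R M], IsFiniteLength R M →
      X (ModuleCat.of R M) := by
    intro M _ _ h
    induction h with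
    | of_subsingleton => exact hs.of_subsingleton hX.nonempty _
    | @of_simple_quotient M _ _ N _ _ ih =>
      obtain ⟨e⟩ :=
        IsSimpleModule.nonempty_linearEquiv_quotient_maximalIdeal (R := R) (M ⧸ N)
      exact ObjectProperty.of_quotient N ih (ObjectProperty.of_linearEquiv e.symm hk)
  exact fun M hM => key M hM

/-- `P` has a simple submodule and `M` a simple quotient, both isomorphic to the residue field,
which is therefore the image of a composite M → R/𝔪 → M. -/
theorem IsIKEClosed.quotient_maximalIdeal_mem (hX : IsIKEClosed X) {M : Type u} [AddCommGroup M]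
    [Module R M] (hM : X (ModuleCat.of R M)) (P : Submodule R M) (hP : P ≠ ⊥)
    (hfl : IsFiniteLength R P) : X (ModuleCat.of R (R ⧸ IsLocalRing.maximalIdeal R)) := by
  have := hX.iso_closed
  have : Module.Finite R M := hX.le_mod _ hM
  have : Nontrivial P := Submodule.nontrivial_iff_ne_bot.mpr hP
  have : Nontrivial M := P.injective_subtype.nontrivial
  have := (isFiniteLength_iff_isNoetherian_isArtinian.mp hfl).2
  obtain ⟨Q, hQ⟩ := IsAtomic.exists_atom (Submodule R P)
  obtain ⟨N, hN⟩ := IsCoatomic.exists_coatom (Submodule R M)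
  have : IsSimpleModule R Q := isSimpleModule_iff_isAtom.mpr hQ
  have : IsSimpleModule R (M ⧸ N) := isSimpleModule_iff_isCoatom.mpr hN
  obtain ⟨e₁⟩ := IsSimpleModule.nonempty_linearEquiv_quotient_maximalIdeal (R := R) (M ⧸ N)
  obtain ⟨e₂⟩ := IsSimpleModule.nonempty_linearEquiv_quotient_maximalIdeal (R := R) Q
  let i : (R ⧸ IsLocalRing.maximalIdeal R) →ₗ[R] M :=
    P.subtype ∘ₗ Q.subtype ∘ₗ e₂.symm.toLinearMap
  have hi : Function.Injective i :=
    P.injective_subtype.comp (Q.injective_subtype.comp e₂.symm.injective)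
  have h := hX.range_mem (i ∘ₗ e₁.toLinearMap ∘ₗ N.mkQ) hM hM
  have hsurj : Function.Surjective (e₁.toLinearMap ∘ₗ N.mkQ) :=
    e₁.surjective.comp N.mkQ_surjective
  rw [LinearMap.range_comp_of_range_eq_top _ (LinearMap.range_eq_top.mpr hsurj)] at h
  exact ObjectProperty.of_linearEquiv (LinearEquiv.ofInjective i hi).symm h

end LocalRing

/-! ### Torsion over a domain. -/

theorem exists_smul_eq_zero_of_not_isTorsionFree {R M : Type*} [CommRing R] [IsDomain R]
    [AddCommGroup M] [Module R M] (h : ¬ Module.IsTorsionFree R M) :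
    ∃ (r : R) (x : M), r ≠ 0 ∧ x ≠ 0 ∧ r • x = 0 := by
  by_contra! hne
  exact h ⟨fun r hr => isSMulRegular_iff_right_eq_zero_of_smul.mpr fun x hx =>
    by_contra fun hx0 => hne r x hr.ne_zero hx0 hx⟩

theorem Submodule.exists_smul_torsion_eq_zero (R M : Type*) [CommRing R] [IsDomain R]
    [IsNoetherianRing R] [AddCommGroup M] [Module R M] [Module.Finite R M] :
    ∃ r : R, r ≠ 0 ∧ ∀ x ∈ Submodule.torsion R M, r • x = 0 := by
  obtain ⟨r, hr, hr0⟩ := Submodule.annihilator_top_inter_nonZeroDivisors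
    (Submodule.torsion_isTorsion (R := R) (M := M))
  exact ⟨r, nonZeroDivisors.ne_zero hr0, fun x hx =>
    congrArg Subtype.val (Submodule.mem_annihilator.mp hr ⟨x, hx⟩ Submodule.mem_top)⟩

/-- For r ≠ 0 the kernel of multiplication by r is exactly the torsion submodule, so rM ≅ M/torsion;
for r = 0 the range is zero. -/
theorem Submodule.isTorsionFree_range_lsmul {R M : Type*} [CommRing R] [IsDomain R]
    [AddCommGroup M] [Module R M] {r : R} (hr : ∀ x ∈ Submodule.torsion R M, r • x = 0) :
    Module.IsTorsionFree R (LinearMap.range (LinearMap.lsmul R M r)) := by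
  by_contra h
  obtain ⟨s, ⟨_, x, rfl⟩, hs, hx, hsx⟩ := exists_smul_eq_zero_of_not_isTorsionFree h
  have hr' : r ≠ 0 := fun h0 => hx (Subtype.ext (by simp [h0]))
  have hsx' : s • r • x = 0 := congrArg Subtype.val hsx
  refine hx (Subtype.ext (hr x ((Submodule.mem_torsion_iff x).mpr
    ⟨⟨s * r, mem_nonZeroDivisors_of_ne_zero (mul_ne_zero hs hr')⟩, ?_⟩)))
  rw [← hsx', smul_smul]
  rfl

/-! ### Classification of the IKE-closed subcategories. -/

namespace PowerSeriesOrder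

open PowerSeries

variable {k : Type u} [Field k] {R : Type u} [CommRing R] [Algebra R k⟦X⟧] {c : ℕ}
  {𝒳 : ObjectProperty (ModuleCat.{u} R)} [Algebra k R] [IsScalarTower k R k⟦X⟧]
  [FaithfulSMul R k⟦X⟧]

theorem tfCat_le_of_powerSeries (hc : ∀ f : k⟦X⟧, X ^ c ∣ f → f ∈ (algebraMap R k⟦X⟧).range)
    (h𝒳 : IsModSubcategory 𝒳) (hs : ClosedUnderSummands 𝒳) [𝒳.IsClosedUnderExtensions]
    (hS : 𝒳 (ModuleCat.of R k⟦X⟧)) : tfCat R ≤ 𝒳 := fun M hM =>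
  have := hM.1
  have := hM.2
  objectProperty_of_isTorsionFree hc h𝒳 hs hS M

theorem isTorsionfreeSubcategory_of_mem
    (hc : ∀ f : k⟦X⟧, X ^ c ∣ f → f ∈ (algebraMap R k⟦X⟧).range)
    (h : 𝒳 = zeroCat R ∨ 𝒳 = flCat R ∨ 𝒳 = tfCat R ∨ 𝒳 = ModuleCat.isFG R) :
    IsTorsionfreeSubcategory 𝒳 := by
  have := isNoetherianRing hc
  obtain rfl | rfl | rfl | rfl := h
  · exact isTorsionfreeSubcategory_zeroCat
  · exact isTorsionfreeSubcategory_flCat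
  · exact isTorsionfreeSubcategory_tfCat
  · exact isTorsionfreeSubcategory_isFG

theorem tfCat_le_of_not_le_flCat (hc : ∀ f : k⟦X⟧, X ^ c ∣ f → f ∈ (algebraMap R k⟦X⟧).range)
    (h𝒳 : IsIKEClosed 𝒳) (h : ¬ 𝒳 ≤ flCat R) : tfCat R ≤ 𝒳 := by
  have := isNoetherianRing hc
  have := isDomain R k
  have := h𝒳.extensions
  obtain ⟨M, hM, hMfl⟩ : ∃ M, 𝒳 M ∧ ¬ flCat R M := by
    by_contra! hne
    exact h hne
  have : Module.Finite R M := h𝒳.le_mod M hM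
  obtain ⟨r, hr, hrt⟩ := Submodule.exists_smul_torsion_eq_zero R M
  have := Submodule.isTorsionFree_range_lsmul hrt
  have : Nontrivial (LinearMap.range (LinearMap.lsmul R M r)) := by
    rw [Submodule.nontrivial_iff_ne_bot]
    intro hbot
    refine hMfl (isFiniteLength_of_smul_eq_zero hc hr fun x => ?_)
    exact (Submodule.mem_bot R).mp (hbot ▸ ⟨x, rfl⟩)
  exact tfCat_le_of_powerSeries hc h𝒳.toIsModSubcategory h𝒳.closedUnderSummands
    (objectProperty_powerSeries_of_isTorsionFree hc h𝒳 _
      (h𝒳.range_mem (LinearMap.lsmul R M r) hM hM))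

theorem flCat_le_of_not_le_tfCat (hc : ∀ f : k⟦X⟧, X ^ c ∣ f → f ∈ (algebraMap R k⟦X⟧).range)
    (h𝒳 : IsIKEClosed 𝒳) (h : ¬ 𝒳 ≤ tfCat R) : flCat R ≤ 𝒳 := by
  have := isLocalRing hc
  have := isDomain R k
  have := h𝒳.extensions
  obtain ⟨M, hM, hMtf⟩ : ∃ M, 𝒳 M ∧ ¬ tfCat R M := by
    by_contra! hne
    exact h hne
  have hfin : Module.Finite R M := h𝒳.le_mod M hM
  obtain ⟨r, x, hr, hx, hrx⟩ := exists_smul_eq_zero_of_not_isTorsionFree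
    (R := R) (M := M) fun h => hMtf ⟨hfin, h⟩
  refine flCat_le_of_quotient_maximalIdeal h𝒳.toIsModSubcategory h𝒳.closedUnderSummands
    (h𝒳.quotient_maximalIdeal_mem hM (Submodule.span R {x}) (by simpa using hx)
      (isFiniteLength_of_smul_eq_zero hc hr ?_))
  rintro ⟨y, hy⟩
  obtain ⟨s, rfl⟩ := Submodule.mem_span_singleton.mp hy
  exact Subtype.ext (by simp [smul_comm r s x, hrx])

theorem isIKEClosed_iff (hc : ∀ f : k⟦X⟧, X ^ c ∣ f → f ∈ (algebraMap R k⟦X⟧).range) :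
    IsIKEClosed 𝒳 ↔
      𝒳 = zeroCat R ∨ 𝒳 = flCat R ∨ 𝒳 = tfCat R ∨ 𝒳 = ModuleCat.isFG R := by
  refine ⟨fun h𝒳 => ?_, fun h => (isTorsionfreeSubcategory_of_mem hc h).isIKEClosed⟩
  have := isNoetherianRing hc
  have := isLocalRing hc
  have := h𝒳.extensions
  have := h𝒳.iso_closed
  by_cases hfl : 𝒳 ≤ flCat R
  · by_cases h0 : 𝒳 ≤ zeroCat R
    · refine Or.inl (le_antisymm h0 fun M hM => ?_)
      have : Subsingleton M := hM
      exact h𝒳.closedUnderSummands.of_subsingleton h𝒳.nonempty M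
    · obtain ⟨M, hM, hM0⟩ : ∃ M, 𝒳 M ∧ ¬ zeroCat R M := by
        by_contra! hne
        exact h0 hne
      have : Nontrivial M := not_subsingleton_iff_nontrivial.mp hM0
      exact Or.inr (Or.inl (le_antisymm hfl (flCat_le_of_quotient_maximalIdeal
        h𝒳.toIsModSubcategory h𝒳.closedUnderSummands (h𝒳.quotient_maximalIdeal_mem hM ⊤ top_ne_bot
          ((hfl M hM).of_injective (Submodule.injective_subtype ⊤))))))
  · have htf' := tfCat_le_of_not_le_flCat hc h𝒳 hfl
    by_cases htf : 𝒳 ≤ tfCat R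
    · exact Or.inr (Or.inr (Or.inl (le_antisymm htf htf')))
    · have hfl' := flCat_le_of_not_le_tfCat hc h𝒳 htf
      have := isDomain R k
      refine Or.inr (Or.inr (Or.inr (le_antisymm h𝒳.le_mod fun M hM => ?_)))
      have : Module.Finite R M := hM
      obtain ⟨r, hr, hrt⟩ := Submodule.exists_smul_torsion_eq_zero R M
      -- Every module is an extension of a torsionfree module by its torsion, which has finite
      -- length.
      refine ObjectProperty.of_quotient (Submodule.torsion R M) (hfl' _ ?_) (htf' _ ?_)
      · exact isFiniteLength_of_smul_eq_zero hc hr fun x => Subtype.ext (hrt x x.2)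
      · exact ⟨inferInstanceAs (Module.Finite R (M ⧸ Submodule.torsion R M)),
          inferInstanceAs (Module.IsTorsionFree R (M ⧸ Submodule.torsion R M))⟩

end PowerSeriesOrder

/-! ### Colon ideals and self-extensions of cyclic modules. -/

/-- If `J / rI` is a complement of `(I ∩ rR) / rI` in `I / rI`, then
`0 → R / I → R / J × R / (I : r) → R / I → 0` is exact, so that `R / (I : r)` is a direct summand
of a self-extension of `R / I`. -/
theorem ClosedUnderSummands.quotient_colon_mem {R : Type u} [CommRing R]
    {X : ObjectProperty (ModuleCat.{u} R)} (hs : ClosedUnderSummands X)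
    [X.IsClosedUnderExtensions] {I J K : Ideal R} (r : R) (hJI : J ≤ I)
    (hJ : ∀ s, r * s ∈ J ↔ s ∈ I) (hIJ : ∀ x ∈ I, ∃ s, x - r * s ∈ J)
    (hK : ∀ s, s ∈ K ↔ r * s ∈ I) (hI : X (ModuleCat.of R (R ⧸ I))) :
    X (ModuleCat.of R (R ⧸ K)) := by
  have hIK : I ≤ K := fun x hx => (hK x).mpr (I.mul_mem_left r hx)
  have hrK : K ≤ LinearMap.ker (I.mkQ ∘ₗ LinearMap.mulLeft R r) := fun x hx => by
    rw [LinearMap.mem_ker, LinearMap.comp_apply, Submodule.mkQ_apply,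
      Submodule.Quotient.mk_eq_zero]
    exact (hK x).mp hx
  have hrI : I ≤ LinearMap.ker (J.mkQ ∘ₗ LinearMap.mulLeft R r) := fun x hx => by
    rw [LinearMap.mem_ker, LinearMap.comp_apply, Submodule.mkQ_apply,
      Submodule.Quotient.mk_eq_zero]
    exact (hJ x).mpr hx
  let f : (R ⧸ I) →ₗ[R] (R ⧸ J) × (R ⧸ K) := (I.liftQ _ hrI).prod (Submodule.factor hIK)
  let g : (R ⧸ J) × (R ⧸ K) →ₗ[R] (R ⧸ I) := (Submodule.factor hJI).coprod (-K.liftQ _ hrK)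
  have hfx : ∀ x : R, f (Submodule.Quotient.mk x) =
    (Submodule.Quotient.mk (r * x), Submodule.Quotient.mk x) := fun x => rfl
  have hgx : ∀ x y : R, g (Submodule.Quotient.mk x, Submodule.Quotient.mk y) =
    Submodule.Quotient.mk (x - r * y) := fun x y => by
      rw [sub_eq_add_neg]; rfl
  refine hs.snd (A := R ⧸ J) (ObjectProperty.of_exact f g ?_ ?_ ?_ hI hI)
  · rw [injective_iff_map_eq_zero]
    intro x hx
    obtain ⟨x, rfl⟩ := Submodule.Quotient.mk_surjective _ x
    rw [hfx] at hx
    exact (Submodule.Quotient.mk_eq_zero I).mpr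
      ((hJ x).mp ((Submodule.Quotient.mk_eq_zero J).mp (congrArg Prod.fst hx)))
  · intro x
    obtain ⟨x, rfl⟩ := Submodule.Quotient.mk_surjective _ x
    exact ⟨(Submodule.Quotient.mk x, Submodule.Quotient.mk 0), by rw [hgx]; simp⟩
  · rintro ⟨x, y⟩
    obtain ⟨x, rfl⟩ := Submodule.Quotient.mk_surjective _ x
    obtain ⟨y, rfl⟩ := Submodule.Quotient.mk_surjective _ y
    rw [hgx, Submodule.Quotient.mk_eq_zero]
    constructor
    · intro h
      -- Modulo `J`, the defect x − ry ∈ I equals some rs; the preimage is then y + s.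
      obtain ⟨s, hsJ⟩ := hIJ _ h
      have hsK : s ∈ K := (hK s).mpr (by
        have := I.sub_mem h (hJI hsJ)
        rwa [sub_sub_cancel] at this)
      refine ⟨Submodule.Quotient.mk (y + s), ?_⟩
      rw [hfx, Prod.mk.injEq, Submodule.Quotient.eq, Submodule.Quotient.eq, add_sub_cancel_left]
      exact ⟨by convert J.neg_mem hsJ using 1; ring, hsK⟩
    · rintro ⟨z, hz⟩
      obtain ⟨z, rfl⟩ := Submodule.Quotient.mk_surjective _ z
      rw [hfx, Prod.mk.injEq, Submodule.Quotient.eq, Submodule.Quotient.eq] at hz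
      have h1 := hJI hz.1
      have h2 := (hK _).mp hz.2
      convert I.sub_mem h2 h1 using 1
      ring

/-! ### Computing the conductor inside a known normalization. -/

/-- Any fraction x/y over `S` equals dx/dy, a fraction over `R`. -/
theorem isFractionRing_of_algebraMap_mul_mem {R S K : Type*} [CommRing R] [CommRing S] [IsDomain S]
    [Field K] [Algebra R S] [Algebra S K] [Algebra R K] [IsScalarTower R S K] [IsFractionRing S K]
    [FaithfulSMul R S] {d : R} (hd : d ≠ 0)
    (h : ∀ s : S, algebraMap R S d * s ∈ (algebraMap R S).range) : IsFractionRing R K := by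
  have := FaithfulSMul.trans R S K
  have hinj := FaithfulSMul.algebraMap_injective R K
  have := hinj.isDomain (algebraMap R K)
  refine IsFractionRing.of_field R K fun z => ?_
  obtain ⟨x, y, hy, rfl⟩ := IsFractionRing.div_surjective (A := S) z
  obtain ⟨p, hp⟩ := h x
  obtain ⟨q, hq⟩ := h y
  have hd' : algebraMap R K d ≠ 0 := (map_ne_zero_iff _ hinj).mpr hd
  refine ⟨p, q, ?_⟩
  rw [IsScalarTower.algebraMap_apply R S K p, IsScalarTower.algebraMap_apply R S K q, hp, hq,
    map_mul, map_mul, ← IsScalarTower.algebraMap_apply R S K, mul_div_mul_left _ _ hd']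

/-- `R` and `S` share a fraction field, and `S`, integral over `R` and integrally closed, is the
integral closure. -/
theorem mem_conductorIdeal_iff {R S : Type u} [CommRing R] [CommRing S] [IsDomain S]
    [IsIntegrallyClosed S] [Algebra R S] [FaithfulSMul R S] [Algebra.IsIntegral R S] {d : R}
    (hd : d ≠ 0) (h : ∀ s : S, algebraMap R S d * s ∈ (algebraMap R S).range) (r : R) :
    r ∈ conductorIdeal R ↔ ∀ s : S, algebraMap R S r * s ∈ (algebraMap R S).range := by
  have := isFractionRing_of_algebraMap_mul_mem (K := FractionRing S) hd h
  have : IsIntegralClosure S R (FractionRing S) := IsIntegralClosure.of_isIntegrallyClosed S R _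
  let e := FractionRing.algEquiv R (FractionRing S)
  have he : ∀ s : S, IsIntegral R (e.symm (algebraMap S (FractionRing S) s)) := fun s =>
    ((IsIntegralClosure.isIntegral_iff (A := S)).mpr ⟨s, rfl⟩).map e.symm
  have hinj := IsFractionRing.injective S (FractionRing S)
  rw [conductorIdeal, Submodule.mem_comap, Submodule.mem_div_iff_forall_mul_mem]
  constructor
  · intro hr s
    obtain ⟨p, hp⟩ := Submodule.mem_one.mp (hr _ (he s))
    refine ⟨p, hinj ?_⟩
    have := congrArg e hp
    rw [map_mul, Algebra.linearMap_apply, e.commutes, e.commutes, e.apply_symm_apply] at this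
    rw [map_mul, ← IsScalarTower.algebraMap_apply, ← IsScalarTower.algebraMap_apply]
    exact this
  · intro hr y hy
    obtain ⟨s, hs⟩ := (IsIntegralClosure.isIntegral_iff (A := S)).mp
      (IsIntegral.map e (show IsIntegral R y from hy))
    obtain ⟨p, hp⟩ := hr s
    refine Submodule.mem_one.mpr ⟨p, e.injective ?_⟩
    rw [map_mul, Algebra.linearMap_apply, e.commutes, e.commutes, ← hs,
      IsScalarTower.algebraMap_apply R S (FractionRing S), hp, map_mul,
      ← IsScalarTower.algebraMap_apply]

/-! ### Order ideals of the semigroup ring. -/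

namespace NumericalSemigroupRing

open PowerSeries PowerSeriesOrder

variable {k : Type u} [Field k] {H : AddSubmonoid ℕ}

noncomputable instance : Algebra k (NumericalSemigroupRing k H) :=
  inferInstanceAs (Algebra k (numericalSemigroupSubalgebra k H))

noncomputable instance : Algebra (NumericalSemigroupRing k H) k⟦X⟧ :=
  inferInstanceAs (Algebra (numericalSemigroupSubalgebra k H) k⟦X⟧)

instance : IsScalarTower k (NumericalSemigroupRing k H) k⟦X⟧ :=
  inferInstanceAs (IsScalarTower k (numericalSemigroupSubalgebra k H) k⟦X⟧)

instance : FaithfulSMul (NumericalSemigroupRing k H) k⟦X⟧ :=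
  inferInstanceAs (FaithfulSMul (numericalSemigroupSubalgebra k H) k⟦X⟧)

theorem algebraMap_injective :
    Function.Injective (algebraMap (NumericalSemigroupRing k H) k⟦X⟧) :=
  FaithfulSMul.algebraMap_injective _ _

theorem mem_range_algebraMap_iff {f : k⟦X⟧} :
    f ∈ (algebraMap (NumericalSemigroupRing k H) k⟦X⟧).range ↔ ∀ n ∉ H, coeff n f = 0 :=
  ⟨fun ⟨r, hr⟩ => hr ▸ r.2, fun h => ⟨⟨f, h⟩, rfl⟩⟩

theorem coeff_algebraMap (r : NumericalSemigroupRing k H) {n : ℕ} (hn : n ∉ H) :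
    coeff n (algebraMap _ k⟦X⟧ r) = 0 := r.2 n hn

theorem X_pow_dvd_mem_range {c : ℕ} (hc : ∀ n ≥ c, n ∈ H) (f : k⟦X⟧) (hf : X ^ c ∣ f) :
    f ∈ (algebraMap (NumericalSemigroupRing k H) k⟦X⟧).range :=
  mem_range_algebraMap_iff.mpr fun n hn => X_pow_dvd_iff.mp hf n (by
    by_contra h
    exact hn (hc n (by lia)))

variable (k H) in
/-- The ideal of the elements of order at least `N`. -/
noncomputable def orderIdeal (N : ℕ) : Ideal (NumericalSemigroupRing k H) :=
  (Ideal.span {(X : k⟦X⟧) ^ N}).comap (algebraMap _ _)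

theorem mem_orderIdeal_iff {N : ℕ} {r : NumericalSemigroupRing k H} :
    r ∈ orderIdeal k H N ↔ X ^ N ∣ algebraMap _ k⟦X⟧ r := by
  rw [orderIdeal, Ideal.mem_comap, Ideal.mem_span_singleton]

theorem mem_orderIdeal_iff_coeff {N : ℕ} {r : NumericalSemigroupRing k H} :
    r ∈ orderIdeal k H N ↔ ∀ n, coeff n (algebraMap _ k⟦X⟧ r) ≠ 0 → N ≤ n := by
  rw [mem_orderIdeal_iff, X_pow_dvd_iff]
  exact forall_congr' fun n => by rw [← not_lt, not_imp_not]

/-- The monomial ideal spanned by the `tⁿ` with `n ∈ T`, for `T` stable under translation by `H`. -/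
noncomputable def monomialIdeal (k : Type u) [Field k] (H : AddSubmonoid ℕ) (T : Set ℕ)
    (hT : ∀ p ∈ H, ∀ q ∈ T, p + q ∈ T) : Ideal (NumericalSemigroupRing k H) where
  carrier := {r | ∀ n, coeff n (algebraMap _ k⟦X⟧ r) ≠ 0 → n ∈ T}
  zero_mem' := fun n hn => absurd (by simp) hn
  add_mem' := fun {r s} hr hs n hn => by
    by_contra h
    refine hn ?_
    rw [map_add, map_add, not_not.mp (mt (hr n) h), not_not.mp (mt (hs n) h), add_zero]
  smul_mem' := fun r s hs n hn => by
    rw [smul_eq_mul, map_mul, coeff_mul] at hn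
    obtain ⟨⟨p, q⟩, hpq, hne⟩ := Finset.exists_ne_zero_of_sum_ne_zero hn
    rw [← show p + q = n by simpa using hpq]
    refine hT p (by_contra fun hp => left_ne_zero_of_mul hne (coeff_algebraMap r hp)) q
      (hs q (right_ne_zero_of_mul hne))

/-- Apply `quotient_colon_mem` with r = t^e and I = I_N, whose colon by t^e is I_{N-e}; truncated
subtraction is harmless, as I_0 = R. -/
theorem quotient_orderIdeal_sub_mem
    {X : ObjectProperty (ModuleCat.{u} (NumericalSemigroupRing k H))}
    (hs : ClosedUnderSummands X) [X.IsClosedUnderExtensions] {e : ℕ} (heH : e ∈ H)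
    (he : ∀ n ∈ H, n ≠ 0 → e ≤ n) {N : ℕ}
    (hN : X (ModuleCat.of _ (NumericalSemigroupRing k H ⧸ orderIdeal k H N))) :
    X (ModuleCat.of _ (NumericalSemigroupRing k H ⧸ orderIdeal k H (N - e))) := by
  obtain ⟨r, hr⟩ : (PowerSeries.X : k⟦X⟧) ^ e ∈
      (algebraMap (NumericalSemigroupRing k H) k⟦X⟧).range :=
    mem_range_algebraMap_iff.mpr fun n hn => by
      rw [coeff_X_pow, if_neg fun h : n = e => hn (h ▸ heH)]
  have hcoeff : ∀ (s : NumericalSemigroupRing k H) (m : ℕ),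
      coeff (m + e) (algebraMap _ k⟦X⟧ (r * s)) = coeff m (algebraMap _ k⟦X⟧ s) := fun s m => by
    rw [map_mul, hr, coeff_X_pow_mul]
  have hcoeff' : ∀ (s : NumericalSemigroupRing k H) (n : ℕ),
      coeff n (algebraMap _ k⟦X⟧ (r * s)) ≠ 0 → ∃ m, n = m + e := fun s n hn => by
    by_contra! h
    refine hn ?_
    rw [map_mul, hr, coeff_X_pow_mul', if_neg]
    exact fun hen => h (n - e) (by lia)
  -- Among the exponents of I_N, `J` drops exactly those in e + H that do not come from t^e I_N.
  refine hs.quotient_colon_mem (J := monomialIdeal k H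
    {n | N ≤ n ∧ ∀ m ∈ H, n = m + e → N ≤ m} ?_) r ?_ ?_ ?_ ?_ hN
  · rintro p hp q ⟨hq, hqm⟩
    refine ⟨by lia, fun m hm hpq => ?_⟩
    by_cases hp0 : p = 0
    -- If p ≠ 0 then p ≥ e, so p + q ≥ N + e and the second condition is automatic.
    · exact hqm m hm (by lia)
    · have := he p hp hp0
      lia
  · exact fun s hs => mem_orderIdeal_iff_coeff.mpr fun n hn => (hs n hn).1
  · intro s
    rw [mem_orderIdeal_iff_coeff]
    constructor
    · intro h n hn
      refine (h (n + e) (by rwa [hcoeff])).2 n ?_ rfl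
      exact by_contra fun hn' => hn (coeff_algebraMap s hn')
    · intro h n hn
      obtain ⟨m, rfl⟩ := hcoeff' s n hn
      rw [hcoeff] at hn
      have := h m hn
      exact ⟨by lia, fun m' _ hm' => by lia⟩
  · intro x hx
    classical
    -- t^e s is the part of `x` supported on e + H; the rest satisfies the second condition
    -- vacuously.
    obtain ⟨s, hs⟩ : PowerSeries.mk (fun m => if m ∈ H then coeff (m + e) (algebraMap _ k⟦X⟧ x)
        else 0) ∈ (algebraMap (NumericalSemigroupRing k H) k⟦X⟧).range :=
      mem_range_algebraMap_iff.mpr fun n hn => by rw [coeff_mk, if_neg hn]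
    refine ⟨s, fun n hn => ?_⟩
    have hnm : ∀ m ∈ H, n ≠ m + e := by
      rintro m hm rfl
      refine hn ?_
      rw [map_sub, map_sub, hcoeff, hs, coeff_mk, if_pos hm, sub_self]
    refine ⟨mem_orderIdeal_iff_coeff.mp hx n fun hx0 => hn ?_, fun m hm hnm' =>
      absurd hnm' (hnm m hm)⟩
    rw [map_sub, map_sub, hx0, zero_sub, neg_eq_zero]
    by_contra h
    obtain ⟨m, rfl⟩ := hcoeff' s n h
    rw [hcoeff, hs, coeff_mk] at h
    exact hnm m (by_contra fun hm => h (if_neg hm)) rfl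
  · intro s
    rw [mem_orderIdeal_iff_coeff, mem_orderIdeal_iff_coeff]
    constructor
    · intro h n hn
      obtain ⟨m, rfl⟩ := hcoeff' s n hn
      rw [hcoeff] at hn
      have := h m hn
      lia
    · intro h n hn
      have := h (n + e) (by rwa [hcoeff])
      lia

theorem quotient_orderIdeal_one_mem
    {X : ObjectProperty (ModuleCat.{u} (NumericalSemigroupRing k H))}
    (hs : ClosedUnderSummands X) [X.IsClosedUnderExtensions] {e : ℕ} (heH : e ∈ H) (he0 : e ≠ 0)
    (he : ∀ n ∈ H, n ≠ 0 → e ≤ n) {N : ℕ} (hN0 : N ≠ 0)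
    (hN : X (ModuleCat.of _ (NumericalSemigroupRing k H ⧸ orderIdeal k H N))) :
    X (ModuleCat.of _ (NumericalSemigroupRing k H ⧸ orderIdeal k H 1)) := by
  induction N using Nat.strong_induction_on with
  | _ N ih =>
    by_cases hNe : N ≤ e
    -- `H` has no element strictly between 0 and e.
    · have : orderIdeal k H 1 = orderIdeal k H N := by
        ext r
        rw [mem_orderIdeal_iff_coeff, mem_orderIdeal_iff_coeff]
        refine forall_congr' fun n => imp_congr_right fun hn => ?_
        have hnH : n ∈ H := by_contra fun h => hn (coeff_algebraMap r h)
        by_cases hn0 : n = 0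
        · lia
        · have := he n hnH hn0
          lia
      rwa [this]
    · exact ih (N - e) (by lia) (by lia) (quotient_orderIdeal_sub_mem hs heH he hN)

theorem orderIdeal_one_eq_maximalIdeal {c : ℕ} (hc : ∀ n ≥ c, n ∈ H)
    [IsLocalRing (NumericalSemigroupRing k H)] :
    orderIdeal k H 1 = IsLocalRing.maximalIdeal (NumericalSemigroupRing k H) := by
  have := isLocalHom_algebraMap (R := NumericalSemigroupRing k H) (X_pow_dvd_mem_range (k := k) hc)
  ext r
  rw [mem_orderIdeal_iff, pow_one, X_dvd_iff, IsLocalRing.mem_maximalIdeal, mem_nonunits_iff,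
    ← isUnit_map_iff (algebraMap (NumericalSemigroupRing k H) k⟦X⟧), isUnit_iff_constantCoeff,
    isUnit_iff_ne_zero, not_not]

theorem isFiniteLength_quotient_orderIdeal {c : ℕ} (hc : ∀ n ≥ c, n ∈ H) (N : ℕ) :
    IsFiniteLength (NumericalSemigroupRing k H) (NumericalSemigroupRing k H ⧸ orderIdeal k H N) := by
  obtain ⟨r, hr⟩ := X_pow_dvd_mem_range (k := k) hc (X ^ (c + N)) (pow_dvd_pow X (by lia))
  have hr0 : r ≠ 0 := fun h => pow_ne_zero (c + N) (X_ne_zero (R := k)) (by rw [← hr, h, map_zero])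
  refine isFiniteLength_of_smul_eq_zero (X_pow_dvd_mem_range (k := k) hc) hr0 fun x => ?_
  obtain ⟨x, rfl⟩ := Submodule.Quotient.mk_surjective _ x
  rw [← Submodule.Quotient.mk_smul, Submodule.Quotient.mk_eq_zero]
  refine Ideal.mul_mem_right x _ (mem_orderIdeal_iff.mpr ?_)
  rw [hr]
  exact pow_dvd_pow X (by lia)

/-- If r = tⁿu lies in the conductor, then so does every t^m = r·u⁻¹t^(m−n), m ≥ n, lie in `R`;
minimality of `c` gives n ≥ c. -/
theorem conductorIdeal_eq_orderIdeal {c : ℕ} (hc : ∀ n ≥ c, n ∈ H)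
    (hmin : ∀ m, (∀ n ≥ m, n ∈ H) → c ≤ m) :
    conductorIdeal (NumericalSemigroupRing k H) = orderIdeal k H c := by
  obtain ⟨d, hd⟩ := X_pow_dvd_mem_range (k := k) hc (X ^ c) dvd_rfl
  have hd0 : d ≠ 0 := fun h => pow_ne_zero c (X_ne_zero (R := k)) (by rw [← hd, h, map_zero])
  have := finite_powerSeries (R := NumericalSemigroupRing k H) (X_pow_dvd_mem_range (k := k) hc)
  ext r
  rw [mem_conductorIdeal_iff (S := k⟦X⟧) hd0
    (fun s => X_pow_dvd_mem_range hc _ (hd ▸ Dvd.intro _ rfl)), mem_orderIdeal_iff]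
  refine ⟨fun h => ?_, fun h s => X_pow_dvd_mem_range hc _ (h.mul_right s)⟩
  by_cases hr : algebraMap _ k⟦X⟧ r = 0
  · rw [hr]; exact dvd_zero _
  obtain ⟨n, u, hu, hru⟩ := PowerSeries.exists_eq_X_pow_mul_isUnit hr
  obtain ⟨v, huv⟩ := hu.exists_right_inv
  rw [hru]
  refine Dvd.dvd.mul_right (pow_dvd_pow X (hmin n fun m hm => ?_)) u
  by_contra hmH
  have := mem_range_algebraMap_iff.mp (h (v * X ^ (m - n))) m hmH
  rw [hru, show X ^ n * u * (v * X ^ (m - n)) = X ^ (n + (m - n)) * (u * v) by ring, huv, mul_one,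
    Nat.add_sub_cancel' hm, coeff_X_pow_self] at this
  exact one_ne_zero this

/-- Both sides are identified with t^c k⟦t⟧. -/
theorem nonempty_orderIdeal_linearEquiv {c : ℕ} (hc : ∀ n ≥ c, n ∈ H) :
    Nonempty (orderIdeal k H c ≃ₗ[NumericalSemigroupRing k H] k⟦X⟧) := by
  let f : orderIdeal k H c →ₗ[NumericalSemigroupRing k H] k⟦X⟧ :=
    Algebra.linearMap _ _ ∘ₗ Submodule.subtype _
  let g : k⟦X⟧ →ₗ[NumericalSemigroupRing k H] k⟦X⟧ :=
    Algebra.lsmul (NumericalSemigroupRing k H) (NumericalSemigroupRing k H) k⟦X⟧ (X ^ c : k⟦X⟧)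
  have hf : Function.Injective f := algebraMap_injective.comp Subtype.val_injective
  have hg : Function.Injective g := mul_right_injective₀ (pow_ne_zero c X_ne_zero)
  have hfg : LinearMap.range f = LinearMap.range g := by
    ext x
    constructor
    · rintro ⟨⟨r, hr⟩, rfl⟩
      obtain ⟨s, hs⟩ := mem_orderIdeal_iff.mp hr
      exact ⟨s, hs.symm⟩
    · rintro ⟨s, rfl⟩
      obtain ⟨r, hr⟩ := X_pow_dvd_mem_range (k := k) hc (X ^ c * s) (Dvd.intro _ rfl)
      exact ⟨⟨r, mem_orderIdeal_iff.mpr (hr ▸ Dvd.intro _ rfl)⟩, hr⟩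
  exact ⟨(LinearEquiv.ofInjective f hf).trans ((LinearEquiv.ofEq _ _ hfg).trans
    (LinearEquiv.ofInjective g hg).symm)⟩

theorem exists_conductorIdeal_eq_orderIdeal (hH : ∃ c, ∀ n ≥ c, n ∈ H) :
    ∃ c, (∀ n ≥ c, n ∈ H) ∧ conductorIdeal (NumericalSemigroupRing k H) = orderIdeal k H c := by
  classical
  exact ⟨Nat.find hH, Nat.find_spec hH,
    conductorIdeal_eq_orderIdeal (Nat.find_spec hH) fun m hm => Nat.find_min' hH hm⟩

theorem extClosure_quotient_conductorIdeal (hH : ∃ c, ∀ n ≥ c, n ∈ H) (h1 : 1 ∉ H) :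
    extClosure (ModuleCat.of (NumericalSemigroupRing k H)
      (NumericalSemigroupRing k H ⧸ conductorIdeal (NumericalSemigroupRing k H))) =
      flCat (NumericalSemigroupRing k H) := by
  obtain ⟨c, hc, hcond⟩ := exists_conductorIdeal_eq_orderIdeal (k := k) hH
  -- Otherwise R = k⟦t⟧ and R/𝔠 = 0, which generates only zero modules.
  have hc0 : c ≠ 0 := fun h => h1 (hc 1 (by lia))
  have hex : ∃ e, e ∈ H ∧ e ≠ 0 := ⟨c, hc c le_rfl, hc0⟩
  have := isLocalRing (X_pow_dvd_mem_range (k := k) hc)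
  rw [hcond]
  refine isTorsionfreeSubcategory_flCat.extClosure_eq (isFiniteLength_quotient_orderIdeal hc c)
    fun Y hY hYc hYs _ => flCat_le_of_quotient_maximalIdeal hY hYs ?_
  rw [← orderIdeal_one_eq_maximalIdeal hc]
  classical
  exact quotient_orderIdeal_one_mem hYs (Nat.find_spec hex).1 (Nat.find_spec hex).2
    (fun n hn hn0 => Nat.find_min' hex ⟨hn, hn0⟩) hc0 hYc

theorem extClosure_conductorIdeal (hH : ∃ c, ∀ n ≥ c, n ∈ H) :
    extClosure (ModuleCat.of (NumericalSemigroupRing k H)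
      (conductorIdeal (NumericalSemigroupRing k H))) = tfCat (NumericalSemigroupRing k H) := by
  obtain ⟨c, hc, hcond⟩ := exists_conductorIdeal_eq_orderIdeal (k := k) hH
  have := isNoetherianRing (X_pow_dvd_mem_range (k := k) hc)
  obtain ⟨e⟩ := nonempty_orderIdeal_linearEquiv (k := k) hc
  rw [hcond]
  refine isTorsionfreeSubcategory_tfCat.extClosure_eq
    ⟨inferInstanceAs (Module.Finite _ (orderIdeal k H c)),
      inferInstanceAs (Module.IsTorsionFree _ (orderIdeal k H c))⟩ fun Y hY hYc hYs _ => ?_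
  have := hY.iso_closed
  exact tfCat_le_of_powerSeries (X_pow_dvd_mem_range (k := k) hc) hY hYs
    (ObjectProperty.of_linearEquiv e hYc)

end NumericalSemigroupRing

theorem AddSubmonoid.exists_forall_ge_mem_closure_pair {a b : ℕ} (h : a.Coprime b) :
    ∃ c, ∀ n ≥ c, n ∈ AddSubmonoid.closure {a, b} := by
  obtain ⟨c, hc⟩ := Nat.exists_mem_closure_of_ge {a, b}
  refine ⟨c, fun n hn => hc n hn ?_⟩
  have hdvd : Nat.setGcd {a, b} ∣ a.gcd b := Nat.dvd_gcd
    (Nat.setGcd_dvd_of_mem (by simp)) (Nat.setGcd_dvd_of_mem (by simp))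
  rw [h] at hdvd
  exact hdvd.trans (one_dvd n)

theorem AddSubmonoid.one_notMem_closure_pair {a b : ℕ} (ha : 1 < a) (hb : 1 < b) :
    1 ∉ AddSubmonoid.closure {a, b} := by
  rw [AddSubmonoid.mem_closure_pair]
  rintro ⟨m, n, h⟩
  simp only [smul_eq_mul] at h
  have hm : m = 0 := by
    by_contra hm
    have := Nat.le_mul_of_pos_left a (Nat.pos_of_ne_zero hm)
    lia
  have hn : n = 0 := by
    by_contra hn
    have := Nat.le_mul_of_pos_left b (Nat.pos_of_ne_zero hn)
    lia
  simp [hm, hn] at h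

theorem theorem6p9 (k : Type u) [Field k] (a b : ℕ) (hab : b < a) (hb : 0 < b)
    (hcop : Nat.Coprime a b)
    (H : AddSubmonoid ℕ) (hH : H = AddSubmonoid.closure {a, b})
    (𝔠 : Ideal (NumericalSemigroupRing k H)) (h𝔠 : 𝔠 = conductorIdeal (NumericalSemigroupRing k H)) :
    ((1 < b →
        extClosure (ModuleCat.of (NumericalSemigroupRing k H) (NumericalSemigroupRing k H ⧸ 𝔠)) =
          flCat (NumericalSemigroupRing k H)) ∧
      extClosure (ModuleCat.of (NumericalSemigroupRing k H) 𝔠) =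
        tfCat (NumericalSemigroupRing k H)) ∧
    ((∀ X : ObjectProperty (ModuleCat.{u} (NumericalSemigroupRing k H)),
        IsIKEClosed X ↔
          X = zeroCat (NumericalSemigroupRing k H) ∨ X = flCat (NumericalSemigroupRing k H) ∨
          X = tfCat (NumericalSemigroupRing k H) ∨
          X = ModuleCat.isFG (NumericalSemigroupRing k H)) ∧
      (∀ X : ObjectProperty (ModuleCat.{u} (NumericalSemigroupRing k H)),
        IsIKEClosed X → IsTorsionfreeSubcategory X)) := by
  have hcof : ∃ c, ∀ n ≥ c, n ∈ H := hH ▸ AddSubmonoid.exists_forall_ge_mem_closure_pair hcop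
  obtain ⟨c, hc⟩ := hcof
  have hcond := NumericalSemigroupRing.X_pow_dvd_mem_range (k := k) hc
  subst h𝔠
  refine ⟨⟨fun hb1 => NumericalSemigroupRing.extClosure_quotient_conductorIdeal ⟨c, hc⟩ ?_,
    NumericalSemigroupRing.extClosure_conductorIdeal ⟨c, hc⟩⟩,
    fun X => PowerSeriesOrder.isIKEClosed_iff hcond,
    fun X hX => PowerSeriesOrder.isTorsionfreeSubcategory_of_mem hcond
      ((PowerSeriesOrder.isIKEClosed_iff hcond).mp hX)⟩
  rw [hH]
  exact AddSubmonoid.one_notMem_closure_pair (by lia) hb1
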